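/- Let $n$ be a natural number, let $0\le s<1$ and let $\frac1{2-s}\le q<1$. Let $M_n(\mathbb C)$ be the space of complex $n\times n$ matrices and $M_n^{++}(\mathbb C)$ the cone of positive definite ones. Then the map $$(A,B)\mapsto \operatorname{tr}\big[(B^*A^{-s}B)^q\big]$$ is jointly convex on $M_n^{++}(\mathbb C)\times M_n(\mathbb C)$; that is, for all $A_1,A_2\in M_n^{++}(\mathbb C)$, all $B_1,B_2\in M_n(\mathbb C)$ and all $\lambda\in[0,1]$, with $A=\lambda A_1+(1-\lambda)A_2$ and $B=\lambda B_1+(1-\lambda)B_2$, $$\operatorname{tr}\big[(B^*A^{-s}B)^q\big]\le \lambda\operatorname{tr}\big[(B_1^*A_1^{-s}B_1)^q\big]+(1-\lambda)\operatorname{tr}\big[(B_2^*A_2^{-s}B_2)^q\big].$$ Here real powers of positive semidefinite matrices are taken by the functional calculus on the spectrum. -/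

import Mathlib

-- The Loewner order on matrices; it provides the real powers `A ^ r` of positive
-- semidefinite matrices through the continuous functional calculus (`CFC.rpow`).
open scoped ComplexOrder MatrixOrder Matrix

/-!
Put `r = (1 - s) q / (1 - q)`. Young's inequality gives, for positive semidefinite `K`,
`tr K^q = inf_Z {q tr(K Z^(s-1)) + (1 - q) tr Z^r}` over positive definite `Z`, and partial
minimization preserves joint convexity. For `K = B* A^(-s) B` the first term is jointly convex in
`(A, B, Z)` for `0 ≤ s < 1` (Lieb, Ando): if `s > 0`, `x^(-s) y^(s-1)` is an integral of multiples
of `(x + t y)⁻¹`, and the form `⟨B, (L_A + t R_Z)⁻¹ B⟩` is the supremum over `X` of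
`2 Re⟨X, B⟩ - ⟨X, A X + t X Z⟩`, which is real-affine in `(A, B, Z)`. The second term is convex
because `r ≥ 1`, and this is exactly what the lower bound on `q` says.
-/

section

open Filter Matrix MeasureTheory Set Topology

section Convexity

variable {E F ι : Type*} [AddCommMonoid E] [Module ℝ E] [AddCommMonoid F] [Module ℝ F] {s : Set E}

theorem convexOn_of_isLUB_range {f : ι → E → ℝ} {g : E → ℝ} (hf : ∀ i, ConvexOn ℝ s (f i))
    (hg : ∀ x ∈ s, IsLUB (range fun i => f i x) (g x)) : ConvexOn ℝ s g := by
  have hs : Convex ℝ s := fun x hx => by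
    obtain ⟨-, i, -⟩ := (hg x hx).nonempty
    exact (hf i).1 hx
  refine ⟨hs, fun x hx y hy a b ha hb hab => (hg _ (hs hx hy ha hb hab)).2 ?_⟩
  rintro - ⟨i, rfl⟩
  calc f i (a • x + b • y) ≤ a • f i x + b • f i y := (hf i).2 hx hy ha hb hab
    _ ≤ a • g x + b • g y := by
        gcongr
        · exact (hg x hx).1 (mem_range_self i)
        · exact (hg y hy).1 (mem_range_self i)

theorem convexOn_of_isGLB_image {t : Set F} {f : E × F → ℝ} {g : E → ℝ}
    (hf : ConvexOn ℝ (s ×ˢ t) f) (hg : ∀ x ∈ s, IsGLB ((fun y => f (x, y)) '' t) (g x)) :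
    ConvexOn ℝ s g := by
  refine ⟨fun x hx y hy a b ha hb hab => ?_, fun x hx y hy a b ha hb hab => ?_⟩
  · obtain ⟨u, hu⟩ := (hg x hx).nonempty.of_image
    exact (hf.1 (mk_mem_prod hx hu) (mk_mem_prod hy hu) ha hb hab).1
  refine le_of_forall_pos_le_add fun ε hε => ?_
  obtain ⟨-, ⟨u, hu, rfl⟩, -, hxu⟩ := (hg x hx).exists_between (lt_add_of_pos_right _ hε)
  obtain ⟨-, ⟨v, hv, rfl⟩, -, hyv⟩ := (hg y hy).exists_between (lt_add_of_pos_right _ hε)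
  obtain ⟨hxy, huv⟩ := hf.1 (mk_mem_prod hx hu) (mk_mem_prod hy hv) ha hb hab
  calc g (a • x + b • y) ≤ f (a • x + b • y, a • u + b • v) :=
        (hg _ hxy).1 (mem_image_of_mem _ huv)
    _ ≤ a • f (x, u) + b • f (y, v) :=
        hf.2 (mk_mem_prod hx hu) (mk_mem_prod hy hv) ha hb hab
    _ ≤ a • (g x + ε) + b • (g y + ε) := by gcongr
    _ = a • g x + b • g y + ε := by
        simp only [smul_eq_mul]
        linear_combination ε * hab

end Convexity

variable {m n 𝕜 : Type*} [RCLike 𝕜]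

theorem two_mul_re_star_mul_sub_mul_sq (x b : 𝕜) {c : ℝ} (hc : c ≠ 0) :
    2 * RCLike.re (star x * b) - c * ‖x‖ ^ 2 =
      c⁻¹ * ‖b‖ ^ 2 - c * ‖x - (c⁻¹ : ℝ) • b‖ ^ 2 := by
  have hinner : RCLike.re (inner 𝕜 x (c⁻¹ • b)) = c⁻¹ * RCLike.re (star x * b) := by
    rw [RCLike.inner_apply, smul_mul_assoc, RCLike.smul_re, mul_comm b, RCLike.star_def]
  rw [@norm_sub_sq 𝕜, hinner, norm_smul, mul_pow, Real.norm_eq_abs, sq_abs]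
  field_simp
  ring

theorem convex_setOf_posDef : Convex ℝ {A : Matrix m m 𝕜 | A.PosDef} :=
  convex_iff_forall_pos.2 fun _ hA _ hB _ _ ha hb _ => (hA.smul ha).add (hB.smul hb)

variable [Fintype m] [Fintype n]

theorem re_trace_conjTranspose_mul (X B : Matrix m n 𝕜) :
    RCLike.re (trace (Xᴴ * B)) = ∑ i, ∑ j, RCLike.re (star (X i j) * B i j) := by
  simp only [trace, diag_apply, mul_apply, map_sum, conjTranspose_apply]
  exact Finset.sum_comm

/-- The quadratic functional of `X` whose critical points, for Hermitian `A` and `Z`, are the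
solutions of the Sylvester equation `α • (A * X) + β • (X * Z) = B`. -/
def sylvesterFunctional (α β : ℝ) (A : Matrix m m 𝕜) (Z : Matrix n n 𝕜) (B X : Matrix m n 𝕜) : ℝ :=
  2 * RCLike.re (trace (Xᴴ * B)) - α * RCLike.re (trace (Xᴴ * A * X)) -
    β * RCLike.re (trace (Xᴴ * X * Z))

/-- The quadratic form `B ↦ ⟨B, (α L_A + β R_Z)⁻¹ B⟩` for the trace inner product, where `L_A` is
left multiplication by `A` and `R_Z` right multiplication by `Z`. It is encoded variationally, which
makes its joint convexity in `(A, B, Z)` visible; an infinite supremum has the junk value `0`. -/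
noncomputable def resolventForm (α β : ℝ) (A : Matrix m m 𝕜) (Z : Matrix n n 𝕜)
    (B : Matrix m n 𝕜) : ℝ :=
  ⨆ X, sylvesterFunctional α β A Z B X

theorem convexOn_sylvesterFunctional (α β : ℝ) (X : Matrix m n 𝕜) :
    ConvexOn ℝ (({A : Matrix m m 𝕜 | A.PosDef} ×ˢ (univ : Set (Matrix m n 𝕜))) ×ˢ
        {Z : Matrix n n 𝕜 | Z.PosDef})
      fun p => sylvesterFunctional α β p.1.1 p.2 p.1.2 X := by
  refine ⟨(convex_setOf_posDef.prod convex_univ).prod convex_setOf_posDef,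
    fun p _ p' _ a b _ _ _ => le_of_eq ?_⟩
  simp only [sylvesterFunctional, Prod.fst_add, Prod.snd_add, Prod.smul_fst, Prod.smul_snd,
    Matrix.mul_add, Matrix.add_mul, Matrix.mul_smul, Matrix.smul_mul, trace_add, trace_smul,
    map_add, RCLike.smul_re, smul_eq_mul]
  ring

section Spectral

variable [DecidableEq m] [DecidableEq n]

theorem re_trace_conjTranspose_mul_diagonal_mul_mul_diagonal (C : Matrix m n 𝕜) (d : m → ℝ)
    (e : n → ℝ) :
    RCLike.re (trace (Cᴴ * diagonal (fun i => (d i : 𝕜)) * C * diagonal (fun j => (e j : 𝕜)))) =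
      ∑ i, ∑ j, d i * e j * ‖C i j‖ ^ 2 := by
  rw [Matrix.mul_assoc, Matrix.mul_assoc, re_trace_conjTranspose_mul]
  refine Finset.sum_congr rfl fun i _ => Finset.sum_congr rfl fun j _ => ?_
  rw [diagonal_mul, mul_diagonal]
  calc RCLike.re (star (C i j) * (d i * (C i j * e j)))
      = RCLike.re ((d i * e j : ℝ) * (star (C i j) * C i j)) := by
        push_cast
        ring_nf
    _ = d i * e j * ‖C i j‖ ^ 2 := by
        rw [RCLike.re_ofReal_mul, RCLike.star_def, RCLike.conj_mul, ← RCLike.ofReal_pow,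
          RCLike.ofReal_re]

theorem cfc_eq_mul_diagonal_mul {A : Matrix m m 𝕜} (hA : A.IsHermitian) (f : ℝ → ℝ) :
    cfc f A = (hA.eigenvectorUnitary : Matrix m m 𝕜) *
      diagonal (fun i => (f (hA.eigenvalues i) : 𝕜)) *
      (hA.eigenvectorUnitary : Matrix m m 𝕜)ᴴ := by
  rw [hA.cfc_eq, IsHermitian.cfc, Unitary.conjStarAlgAut_apply]
  rfl

theorem re_trace_cfc {A : Matrix m m 𝕜} (hA : A.IsHermitian) (f : ℝ → ℝ) :
    RCLike.re (trace (cfc f A)) = ∑ i, f (hA.eigenvalues i) := by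
  rw [cfc_eq_mul_diagonal_mul hA, trace_mul_comm, ← Matrix.mul_assoc,
    show (hA.eigenvectorUnitary : Matrix m m 𝕜)ᴴ * hA.eigenvectorUnitary = 1 from
      Unitary.coe_star_mul_self _]
  simp [trace]

section SpectralForm

variable {A : Matrix m m 𝕜} {Z : Matrix n n 𝕜}

/-- The matrix of `B` in the eigenbases of `Z` (for the source) and `A` (for the target). -/
noncomputable def eigenCoeff (hA : A.IsHermitian) (hZ : Z.IsHermitian) (B : Matrix m n 𝕜) :
    Matrix m n 𝕜 :=
  (hA.eigenvectorUnitary : Matrix m m 𝕜)ᴴ * B * (hZ.eigenvectorUnitary : Matrix n n 𝕜)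

/-- The quadratic form `B ↦ ⟨B, k(L_A, R_Z) B⟩` for the trace inner product, where `L_A` is left
multiplication by `A` and `R_Z` right multiplication by `Z`: these commute, and `k` is applied to
their joint spectrum. -/
noncomputable def spectralForm (hA : A.IsHermitian) (hZ : Z.IsHermitian) (k : ℝ → ℝ → ℝ)
    (B : Matrix m n 𝕜) : ℝ :=
  ∑ i, ∑ j, k (hA.eigenvalues i) (hZ.eigenvalues j) * ‖eigenCoeff hA hZ B i j‖ ^ 2

theorem eigenCoeff_surjective (hA : A.IsHermitian) (hZ : Z.IsHermitian) :
    Function.Surjective (eigenCoeff (𝕜 := 𝕜) hA hZ) := by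
  intro Y
  refine ⟨(hA.eigenvectorUnitary : Matrix m m 𝕜) * Y * (hZ.eigenvectorUnitary : Matrix n n 𝕜)ᴴ, ?_⟩
  have hU : (hA.eigenvectorUnitary : Matrix m m 𝕜)ᴴ * hA.eigenvectorUnitary = 1 :=
    Unitary.coe_star_mul_self _
  have hV : (hZ.eigenvectorUnitary : Matrix n n 𝕜)ᴴ * hZ.eigenvectorUnitary = 1 :=
    Unitary.coe_star_mul_self _
  simp only [eigenCoeff, Matrix.mul_assoc, hV, Matrix.mul_one]
  rw [← Matrix.mul_assoc, hU, Matrix.one_mul]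

theorem trace_conjTranspose_eigenCoeff_mul (hA : A.IsHermitian) (hZ : Z.IsHermitian)
    (X B : Matrix m n 𝕜) :
    trace ((eigenCoeff hA hZ X)ᴴ * eigenCoeff hA hZ B) = trace (Xᴴ * B) := by
  have hU : (hA.eigenvectorUnitary : Matrix m m 𝕜) * (hA.eigenvectorUnitary : Matrix m m 𝕜)ᴴ = 1 :=
    Unitary.coe_mul_star_self _
  have hV : (hZ.eigenvectorUnitary : Matrix n n 𝕜) * (hZ.eigenvectorUnitary : Matrix n n 𝕜)ᴴ = 1 :=
    Unitary.coe_mul_star_self _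
  simp only [eigenCoeff, conjTranspose_mul, conjTranspose_conjTranspose, Matrix.mul_assoc]
  rw [trace_mul_comm]
  simp only [Matrix.mul_assoc, hV, Matrix.mul_one]
  rw [← Matrix.mul_assoc _ _ B, hU, Matrix.one_mul]

theorem re_trace_conjTranspose_mul_cfc_mul_mul_cfc (hA : A.IsHermitian) (hZ : Z.IsHermitian)
    (f g : ℝ → ℝ) (B : Matrix m n 𝕜) :
    RCLike.re (trace (Bᴴ * cfc f A * B * cfc g Z)) =
      spectralForm hA hZ (fun x y => f x * g y) B := by
  rw [spectralForm, ← re_trace_conjTranspose_mul_diagonal_mul_mul_diagonal,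
    cfc_eq_mul_diagonal_mul hA, cfc_eq_mul_diagonal_mul hZ]
  simp only [eigenCoeff, conjTranspose_mul, conjTranspose_conjTranspose]
  rw [← Matrix.mul_assoc, trace_mul_comm]
  simp only [Matrix.mul_assoc]

theorem spectralForm_mono (hA : A.IsHermitian) (hZ : Z.IsHermitian) {k l : ℝ → ℝ → ℝ}
    (h : ∀ x ∈ spectrum ℝ A, ∀ y ∈ spectrum ℝ Z, k x y ≤ l x y) (B : Matrix m n 𝕜) :
    spectralForm hA hZ k B ≤ spectralForm hA hZ l B := by
  unfold spectralForm
  gcongr with i _ j _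
  exact h _ (hA.eigenvalues_mem_spectrum_real i) _ (hZ.eigenvalues_mem_spectrum_real j)

theorem spectralForm_congr (hA : A.IsHermitian) (hZ : Z.IsHermitian) {k l : ℝ → ℝ → ℝ}
    (h : ∀ x ∈ spectrum ℝ A, ∀ y ∈ spectrum ℝ Z, k x y = l x y) (B : Matrix m n 𝕜) :
    spectralForm hA hZ k B = spectralForm hA hZ l B :=
  (spectralForm_mono hA hZ (fun x hx y hy => (h x hx y hy).le) B).antisymm
    (spectralForm_mono hA hZ (fun x hx y hy => (h x hx y hy).ge) B)

theorem integrable_spectralForm (hA : A.IsHermitian) (hZ : Z.IsHermitian) {T : Type*}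
    [MeasurableSpace T] {μ : Measure T} {k : T → ℝ → ℝ → ℝ}
    (hk : ∀ x ∈ spectrum ℝ A, ∀ y ∈ spectrum ℝ Z, Integrable (fun t => k t x y) μ)
    (B : Matrix m n 𝕜) : Integrable (fun t => spectralForm hA hZ (k t) B) μ :=
  integrable_finsetSum _ fun i _ => integrable_finsetSum _ fun j _ =>
    (hk _ (hA.eigenvalues_mem_spectrum_real i) _ (hZ.eigenvalues_mem_spectrum_real j)).mul_const _

theorem integral_spectralForm (hA : A.IsHermitian) (hZ : Z.IsHermitian) {T : Type*}
    [MeasurableSpace T] {μ : Measure T} {k : T → ℝ → ℝ → ℝ}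
    (hk : ∀ x ∈ spectrum ℝ A, ∀ y ∈ spectrum ℝ Z, Integrable (fun t => k t x y) μ)
    (B : Matrix m n 𝕜) :
    ∫ t, spectralForm hA hZ (k t) B ∂μ = spectralForm hA hZ (fun x y => ∫ t, k t x y ∂μ) B := by
  have hint (i : m) (j : n) :=
    (hk _ (hA.eigenvalues_mem_spectrum_real i) _ (hZ.eigenvalues_mem_spectrum_real j)).mul_const
      (‖eigenCoeff hA hZ B i j‖ ^ 2)
  simp only [spectralForm]
  rw [integral_finsetSum _ fun i _ => integrable_finsetSum _ fun j _ => hint i j]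
  refine Finset.sum_congr rfl fun i _ => ?_
  rw [integral_finsetSum _ fun j _ => hint i j]
  simp only [integral_mul_const]

end SpectralForm

section Sylvester

variable {A : Matrix m m 𝕜} {Z : Matrix n n 𝕜} {α β : ℝ}

theorem sylvesterFunctional_eq_sum (hA : A.IsHermitian) (hZ : Z.IsHermitian) (α β : ℝ)
    (B X : Matrix m n 𝕜) :
    sylvesterFunctional α β A Z B X =
      ∑ i, ∑ j, (2 * RCLike.re (star (eigenCoeff hA hZ X i j) * eigenCoeff hA hZ B i j) -
        (α * hA.eigenvalues i + β * hZ.eigenvalues j) * ‖eigenCoeff hA hZ X i j‖ ^ 2) := by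
  have hleft := re_trace_conjTranspose_mul_cfc_mul_mul_cfc hA hZ (fun x => x) (fun _ => 1) X
  have hright := re_trace_conjTranspose_mul_cfc_mul_mul_cfc hA hZ (fun _ => 1) (fun y => y) X
  rw [cfc_id' ℝ A hA.isSelfAdjoint, cfc_const_one ℝ Z hZ.isSelfAdjoint, Matrix.mul_one] at hleft
  rw [cfc_id' ℝ Z hZ.isSelfAdjoint, cfc_const_one ℝ A hA.isSelfAdjoint, Matrix.mul_one] at hright
  rw [sylvesterFunctional, hleft, hright, ← trace_conjTranspose_eigenCoeff_mul hA hZ,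
    re_trace_conjTranspose_mul]
  simp only [spectralForm, Finset.mul_sum, ← Finset.sum_sub_distrib]
  refine Finset.sum_congr rfl fun i _ => Finset.sum_congr rfl fun j _ => ?_
  ring

theorem isGreatest_range_sylvesterFunctional (hA : A.IsHermitian) (hZ : Z.IsHermitian)
    (hpos : ∀ x ∈ spectrum ℝ A, ∀ y ∈ spectrum ℝ Z, 0 < α * x + β * y) (B : Matrix m n 𝕜) :
    IsGreatest (range (sylvesterFunctional α β A Z B))
      (spectralForm hA hZ (fun x y => (α * x + β * y)⁻¹) B) := by
  have hc (i : m) (j : n) : 0 < α * hA.eigenvalues i + β * hZ.eigenvalues j :=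
    hpos _ (hA.eigenvalues_mem_spectrum_real i) _ (hZ.eigenvalues_mem_spectrum_real j)
  have hsq (X : Matrix m n 𝕜) := sylvesterFunctional_eq_sum hA hZ α β B X
  simp only [two_mul_re_star_mul_sub_mul_sq _ _ (hc _ _).ne'] at hsq
  constructor
  · obtain ⟨X, hX⟩ := eigenCoeff_surjective hA hZ
      (of fun i j => (α * hA.eigenvalues i + β * hZ.eigenvalues j)⁻¹ • eigenCoeff hA hZ B i j)
    refine ⟨X, (hsq X).trans ?_⟩
    simp [hX, spectralForm]
  · rintro - ⟨X, rfl⟩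
    rw [hsq, spectralForm]
    gcongr with i _ j _
    exact sub_le_self _ (mul_nonneg (hc i j).le (sq_nonneg _))

theorem isGreatest_range_sylvesterFunctional_of_posDef (hA : A.PosDef) (hZ : Z.PosDef)
    (hα : 0 ≤ α) (hβ : 0 < β) (B : Matrix m n 𝕜) :
    IsGreatest (range (sylvesterFunctional α β A Z B))
      (spectralForm hA.isHermitian hZ.isHermitian (fun x y => (α * x + β * y)⁻¹) B) :=
  isGreatest_range_sylvesterFunctional _ _ (fun _ hx _ hy => add_pos_of_nonneg_of_pos
    (mul_nonneg hα (hA.isStrictlyPositive.spectrum_pos hx).le)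
    (mul_pos hβ (hZ.isStrictlyPositive.spectrum_pos hy))) B

theorem resolventForm_eq_spectralForm (hA : A.PosDef) (hZ : Z.PosDef) (hα : 0 ≤ α) (hβ : 0 < β)
    (B : Matrix m n 𝕜) :
    resolventForm α β A Z B =
      spectralForm hA.isHermitian hZ.isHermitian (fun x y => (α * x + β * y)⁻¹) B :=
  (isGreatest_range_sylvesterFunctional_of_posDef hA hZ hα hβ B).csSup_eq

end Sylvester

end Spectral

theorem convexOn_resolventForm {α β : ℝ} (hα : 0 ≤ α) (hβ : 0 < β) :
    ConvexOn ℝ (({A : Matrix m m 𝕜 | A.PosDef} ×ˢ (univ : Set (Matrix m n 𝕜))) ×ˢ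
        {Z : Matrix n n 𝕜 | Z.PosDef})
      fun p => resolventForm α β p.1.1 p.2 p.1.2 := by
  classical
  refine convexOn_of_isLUB_range (convexOn_sylvesterFunctional α β) ?_
  rintro ⟨⟨A, B⟩, Z⟩ ⟨⟨hA, -⟩, hZ⟩
  rw [resolventForm_eq_spectralForm hA hZ hα hβ]
  exact (isGreatest_range_sylvesterFunctional_of_posDef hA hZ hα hβ B).isLUB

theorem exists_measure_rpow_mul_rpow_eq_integral {s : ℝ} (hs : s ∈ Ioo (0 : ℝ) 1) :
    ∃ μ : Measure ℝ, ∀ x > 0, ∀ y > 0,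
      IntegrableOn (fun t => t ^ (-s) * (x + t * y)⁻¹) (Ioi 0) μ ∧
        x ^ (-s) * y ^ (s - 1) = ∫ t in Ioi 0, t ^ (-s) * (x + t * y)⁻¹ ∂μ := by
  have hp : 1 - s ∈ Ioo (0 : ℝ) 1 := ⟨sub_pos.2 hs.2, sub_lt_self _ hs.1⟩
  obtain ⟨μ, hμ⟩ := Real.exists_measure_rpow_eq_integral_rpowIntegrand₀₁ hp
  refine ⟨μ, fun x hx y hy => ?_⟩
  obtain ⟨hint, heq⟩ := hμ (x / y) (div_pos hx hy).le
  have hcongr : EqOn (fun t => x⁻¹ * Real.rpowIntegrand₀₁ (1 - s) t (x / y))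
      (fun t => t ^ (-s) * (x + t * y)⁻¹) (Ioi 0) := by
    intro t (ht : 0 < t)
    have hdiv : t + x / y = (x + t * y) / y := by field_simp; ring
    simp only [Real.rpowIntegrand₀₁_eq_pow_div hp ht.le (div_pos hx hy).le, hdiv]
    rw [show 1 - s - 1 = -s by ring]
    field_simp
  refine ⟨(integrableOn_congr_fun hcongr measurableSet_Ioi).1 (hint.const_mul x⁻¹), ?_⟩
  rw [← setIntegral_congr_fun measurableSet_Ioi hcongr, integral_const_mul, ← heq,
    Real.div_rpow hx.le hy.le, Real.rpow_sub hx, Real.rpow_neg hx.le, Real.rpow_sub hy,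
    Real.rpow_sub hy, Real.rpow_one, Real.rpow_one]
  field_simp

variable [DecidableEq m] [DecidableEq n]

theorem re_trace_conjTranspose_mul_rpow_mul_mul_rpow {A : Matrix m m 𝕜} {Z : Matrix n n 𝕜}
    (hA : A.PosSemidef) (hZ : Z.PosSemidef) (a b : ℝ) (B : Matrix m n 𝕜) :
    RCLike.re (trace (Bᴴ * A ^ a * B * Z ^ b)) =
      spectralForm hA.isHermitian hZ.isHermitian (fun x y => x ^ a * y ^ b) B := by
  rw [CFC.rpow_eq_cfc_real hA.nonneg, CFC.rpow_eq_cfc_real hZ.nonneg,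
    re_trace_conjTranspose_mul_cfc_mul_mul_cfc]

theorem exists_measure_re_trace_eq_integral_resolventForm {s : ℝ} (hs : s ∈ Ioo (0 : ℝ) 1) :
    ∃ μ : Measure ℝ, ∀ (A : Matrix m m 𝕜) (Z : Matrix n n 𝕜) (B : Matrix m n 𝕜), A.PosDef →
      Z.PosDef → IntegrableOn (fun t => t ^ (-s) * resolventForm 1 t A Z B) (Ioi 0) μ ∧
        RCLike.re (trace (Bᴴ * A ^ (-s) * B * Z ^ (s - 1))) =
          ∫ t in Ioi 0, t ^ (-s) * resolventForm 1 t A Z B ∂μ := by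
  obtain ⟨μ, hμ⟩ := exists_measure_rpow_mul_rpow_eq_integral hs
  refine ⟨μ, fun A Z B hA hZ => ?_⟩
  have hcongr : EqOn (fun t => spectralForm hA.isHermitian hZ.isHermitian
      (fun x y => t ^ (-s) * (x + t * y)⁻¹) B)
      (fun t => t ^ (-s) * resolventForm 1 t A Z B) (Ioi 0) := by
    intro t ht
    simp only [resolventForm_eq_spectralForm hA hZ zero_le_one ht, spectralForm, one_mul,
      Finset.mul_sum, mul_assoc]
  have hposA : ∀ x ∈ spectrum ℝ A, 0 < x := fun _ => hA.isStrictlyPositive.spectrum_pos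
  have hposZ : ∀ y ∈ spectrum ℝ Z, 0 < y := fun _ => hZ.isStrictlyPositive.spectrum_pos
  have hint : ∀ x ∈ spectrum ℝ A, ∀ y ∈ spectrum ℝ Z,
      IntegrableOn (fun t => t ^ (-s) * (x + t * y)⁻¹) (Ioi 0) μ :=
    fun x hx y hy => (hμ x (hposA x hx) y (hposZ y hy)).1
  refine ⟨(integrableOn_congr_fun hcongr measurableSet_Ioi).1 (integrable_spectralForm _ _ hint B),
    ?_⟩
  rw [← setIntegral_congr_fun measurableSet_Ioi hcongr, integral_spectralForm _ _ hint,
    re_trace_conjTranspose_mul_rpow_mul_mul_rpow hA.posSemidef hZ.posSemidef]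
  exact spectralForm_congr _ _ (fun x hx y hy => (hμ x (hposA x hx) y (hposZ y hy)).2) B

theorem convexOn_re_trace_conjTranspose_mul_rpow_mul_mul_rpow {s : ℝ} (hs0 : 0 ≤ s) (hs1 : s < 1) :
    ConvexOn ℝ (({A : Matrix m m 𝕜 | A.PosDef} ×ˢ (univ : Set (Matrix m n 𝕜))) ×ˢ
        {Z : Matrix n n 𝕜 | Z.PosDef})
      fun p => RCLike.re (trace (p.1.2ᴴ * p.1.1 ^ (-s) * p.1.2 * p.2 ^ (s - 1))) := by
  rcases hs0.eq_or_lt with rfl | hs0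
  · refine (convexOn_resolventForm le_rfl one_pos).congr ?_
    rintro ⟨⟨A, B⟩, Z⟩ ⟨⟨hA, -⟩, hZ⟩
    have hres := resolventForm_eq_spectralForm hA hZ le_rfl one_pos B
    have htrace := re_trace_conjTranspose_mul_rpow_mul_mul_rpow hA.posSemidef hZ.posSemidef 0 (-1) B
    simpa [Real.rpow_neg_one, htrace] using hres
  obtain ⟨μ, hμ⟩ := exists_measure_re_trace_eq_integral_resolventForm (m := m) (n := n) (𝕜 := 𝕜)
    ⟨hs0, hs1⟩
  have hint := integral_convexOn_of_integrand_ae (μ := μ.restrict (Ioi 0))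
    (f := fun (t : ℝ) (p : (Matrix m m 𝕜 × Matrix m n 𝕜) × Matrix n n 𝕜) =>
      t ^ (-s) * resolventForm 1 t p.1.1 p.2 p.1.2)
    (convexOn_resolventForm zero_le_one one_pos).1
    (ae_restrict_of_forall_mem measurableSet_Ioi fun t ht =>
      (convexOn_resolventForm zero_le_one ht).smul (Real.rpow_nonneg (le_of_lt ht) _))
    fun p hp => (hμ p.1.1 p.2 p.1.2 hp.1.1 hp.2).1
  exact hint.congr fun p hp => (hμ p.1.1 p.2 p.1.2 hp.1.1 hp.2).2.symm

section TraceInequalities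

variable {A Z : Matrix n n 𝕜} {q r t : ℝ}

-- Klein's principle: `A` and `Z` need not commute, because both sides are sums over pairs of an
-- eigenvector of `A` and one of `Z`, weighted by the squared modulus of their inner product.
theorem mul_re_trace_cfc_le (hA : A.IsHermitian) (hZ : Z.IsHermitian) {f g h : ℝ → ℝ} {a b c : ℝ}
    (H : ∀ x ∈ spectrum ℝ A, ∀ y ∈ spectrum ℝ Z, a * f x ≤ b * (x * g y) + c * h y) :
    a * RCLike.re (trace (cfc f A)) ≤
      b * RCLike.re (trace (A * cfc g Z)) + c * RCLike.re (trace (cfc h Z)) := by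
  have hone (k : ℝ → ℝ) (l : ℝ → ℝ) : RCLike.re (trace (cfc k A * cfc l Z)) =
      spectralForm hA hZ (fun x y => k x * l y) 1 := by
    simpa using re_trace_conjTranspose_mul_cfc_mul_mul_cfc hA hZ k l 1
  have hf := hone f fun _ => 1
  have hg := hone (fun x => x) g
  have hh := hone (fun _ => 1) h
  rw [cfc_const_one ℝ Z hZ.isSelfAdjoint, Matrix.mul_one] at hf
  rw [cfc_id' ℝ A hA.isSelfAdjoint] at hg
  rw [cfc_const_one ℝ A hA.isSelfAdjoint, Matrix.one_mul] at hh
  have hmono := spectralForm_mono hA hZ H 1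
  rw [hf, hg, hh]
  simpa only [spectralForm, Finset.mul_sum, ← Finset.sum_add_distrib, mul_one, one_mul, add_mul,
    mul_assoc] using hmono

theorem re_trace_mul_rpow_add_le (hA : A.PosSemidef) (hZ : Z.PosDef) (hr : 1 ≤ r) :
    r * RCLike.re (trace (A * Z ^ (r - 1))) + (1 - r) * RCLike.re (trace (Z ^ r)) ≤
      RCLike.re (trace (A ^ r)) := by
  have hscalar : ∀ x ∈ spectrum ℝ A, ∀ y ∈ spectrum ℝ Z,
      -1 * x ^ r ≤ -r * (x * y ^ (r - 1)) + (r - 1) * y ^ r := by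
    intro x hxA y hyZ
    have hx : 0 ≤ x := spectrum_nonneg_of_nonneg hA.nonneg hxA
    have hy : 0 < y := hZ.isStrictlyPositive.spectrum_pos hyZ
    have hbern := one_add_mul_self_le_rpow_one_add (s := x / y - 1)
      (by linarith [div_nonneg hx hy.le]) hr
    rw [add_sub_cancel, Real.div_rpow hx hy.le, le_div_iff₀ (Real.rpow_pos_of_pos hy r)] at hbern
    have hexpand : (1 + r * (x / y - 1)) * y ^ r = r * (x * y ^ (r - 1)) + (1 - r) * y ^ r := by
      rw [Real.rpow_sub_one hy.ne']
      ring
    linarith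
  have hklein := mul_re_trace_cfc_le hA.isHermitian hZ.isHermitian hscalar
  rw [CFC.rpow_eq_cfc_real hA.nonneg, CFC.rpow_eq_cfc_real hZ.posSemidef.nonneg,
    CFC.rpow_eq_cfc_real hZ.posSemidef.nonneg]
  linarith

theorem convexOn_re_trace_rpow (hr : 1 ≤ r) :
    ConvexOn ℝ {Z : Matrix n n 𝕜 | Z.PosDef} fun Z => RCLike.re (trace (Z ^ r)) := by
  refine convexOn_of_isLUB_range (ι := {W : Matrix n n 𝕜 // W.PosDef})
    (f := fun W Z => r * RCLike.re (trace (Z * W.1 ^ (r - 1))) +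
      (1 - r) * RCLike.re (trace (W.1 ^ r))) (fun W => ?_) fun Z hZ => IsGreatest.isLUB ⟨?_, ?_⟩
  · refine ⟨convex_setOf_posDef, fun Z _ Z' _ a b _ _ hab => le_of_eq ?_⟩
    simp only [Matrix.add_mul, Matrix.smul_mul, trace_add, trace_smul, map_add, RCLike.smul_re,
      smul_eq_mul]
    linear_combination -(1 - r) * RCLike.re (trace (W.1 ^ r)) * hab
  · refine ⟨⟨Z, hZ⟩, ?_⟩
    have hpow : Z * Z ^ (r - 1) = Z ^ r := by
      rw [← add_sub_cancel 1 r, CFC.rpow_add hZ.isUnit, CFC.rpow_one Z hZ.posSemidef.nonneg,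
        add_sub_cancel]
    simp only [hpow]
    ring
  · rintro - ⟨W, rfl⟩
    exact re_trace_mul_rpow_add_le hZ.posSemidef W.2 hr

theorem re_trace_rpow_le_mul_add_mul (hA : A.PosSemidef) (hZ : Z.PosDef) (hq0 : 0 < q)
    (hq1 : q < 1) (t : ℝ) :
    RCLike.re (trace (A ^ q)) ≤ q * RCLike.re (trace (A * Z ^ (-t))) +
      (1 - q) * RCLike.re (trace (Z ^ (t * q / (1 - q)))) := by
  have hscalar : ∀ x ∈ spectrum ℝ A, ∀ y ∈ spectrum ℝ Z,
      1 * x ^ q ≤ q * (x * y ^ (-t)) + (1 - q) * y ^ (t * q / (1 - q)) := by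
    intro x hxA y hyZ
    have hx : 0 ≤ x := spectrum_nonneg_of_nonneg hA.nonneg hxA
    have hy : 0 < y := hZ.isStrictlyPositive.spectrum_pos hyZ
    have hexp : -t * q + t * q / (1 - q) * (1 - q) = 0 := by
      rw [div_mul_cancel₀ _ (sub_ne_zero.2 hq1.ne'), neg_mul, neg_add_cancel]
    calc 1 * x ^ q = (x * y ^ (-t)) ^ q * (y ^ (t * q / (1 - q))) ^ (1 - q) := by
          rw [Real.mul_rpow hx (Real.rpow_nonneg hy.le _), ← Real.rpow_mul hy.le,
            ← Real.rpow_mul hy.le, mul_assoc, ← Real.rpow_add hy, hexp, Real.rpow_zero, mul_one,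
            one_mul]
      _ ≤ q * (x * y ^ (-t)) + (1 - q) * y ^ (t * q / (1 - q)) :=
          Real.geom_mean_le_arith_mean2_weighted hq0.le (sub_nonneg.2 hq1.le)
            (mul_nonneg hx (Real.rpow_nonneg hy.le _)) (Real.rpow_nonneg hy.le _) (by ring)
  simpa only [CFC.rpow_eq_cfc_real hA.nonneg, CFC.rpow_eq_cfc_real hZ.posSemidef.nonneg, one_mul]
    using mul_re_trace_cfc_le hA.isHermitian hZ.isHermitian hscalar

theorem posDef_rpow (hA : A.PosDef) (a : ℝ) : (A ^ a).PosDef :=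
  (IsStrictlyPositive.rpow A a hA.isStrictlyPositive).posDef

theorem re_trace_mul_rpow_add_re_trace_rpow_eq (hA : A.PosDef) (hq : q < 1) (ht : t ≠ 0) :
    q * RCLike.re (trace (A * (A ^ ((1 - q) / t)) ^ (-t))) +
      (1 - q) * RCLike.re (trace ((A ^ ((1 - q) / t)) ^ (t * q / (1 - q)))) =
      RCLike.re (trace (A ^ q)) := by
  have hq' : 1 - q ≠ 0 := (sub_pos.2 hq).ne'
  have hmul : A * (A ^ ((1 - q) / t)) ^ (-t) = A ^ q := by
    nth_rewrite 1 [← CFC.rpow_one A hA.posSemidef.nonneg]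
    rw [CFC.rpow_rpow _ _ _ (div_ne_zero hq' ht) hA.isStrictlyPositive, ← CFC.rpow_add hA.isUnit]
    congr 1
    field_simp
    ring
  have hpow : (A ^ ((1 - q) / t)) ^ (t * q / (1 - q)) = A ^ q := by
    rw [CFC.rpow_rpow _ _ _ (div_ne_zero hq' ht) hA.isStrictlyPositive]
    congr 1
    field_simp
  rw [hmul, hpow]
  ring

theorem re_trace_mul_le_re_trace_add_smul_one_mul {W : Matrix n n 𝕜} (hW : W.PosSemidef) {ε : ℝ}
    (hε : 0 ≤ ε) (A : Matrix n n 𝕜) :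
    RCLike.re (trace (A * W)) ≤ RCLike.re (trace ((A + ε • 1) * W)) := by
  rw [Matrix.add_mul, trace_add, map_add, Matrix.smul_mul, Matrix.one_mul, trace_smul,
    RCLike.smul_re]
  exact le_add_of_nonneg_right (mul_nonneg hε (RCLike.nonneg_iff.1 hW.trace_nonneg).1)

theorem tendsto_re_trace_add_smul_one_rpow (hA : A.PosSemidef) (hq : 0 < q) :
    Tendsto (fun ε : ℝ => RCLike.re (trace ((A + ε • 1) ^ q))) (𝓝[>] 0)
      (𝓝 (RCLike.re (trace (A ^ q)))) := by
  have hshift : ∀ ε > 0, RCLike.re (trace ((A + ε • 1) ^ q)) =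
      ∑ i, (hA.isHermitian.eigenvalues i + ε) ^ q := by
    intro ε hε
    have hcfc : A + ε • 1 = cfc (fun x : ℝ => x + ε) A := by
      rw [cfc_add_const ε (fun x => x) A, cfc_id' ℝ A hA.isHermitian.isSelfAdjoint,
        Algebra.algebraMap_eq_smul_one]
    rw [hcfc, CFC.cfc_rpow fun x hx => add_pos_of_nonneg_of_pos
      (spectrum_nonneg_of_nonneg hA.nonneg hx) hε, re_trace_cfc hA.isHermitian]
  have hcont : Continuous fun ε : ℝ => ∑ i, (hA.isHermitian.eigenvalues i + ε) ^ q :=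
    continuous_finsetSum _ fun i _ => (by fun_prop : Continuous _).rpow_const fun _ => .inr hq.le
  have hlim := (hcont.tendsto 0).mono_left (nhdsWithin_le_nhds (s := Ioi 0))
  simp only [add_zero, ← re_trace_cfc hA.isHermitian (fun x => x ^ q)] at hlim
  rw [← CFC.rpow_eq_cfc_real hA.nonneg] at hlim
  exact hlim.congr' (eventually_nhdsWithin_of_forall fun ε hε => (hshift ε hε).symm)

theorem isGLB_image_re_trace_rpow (hA : A.PosSemidef) (hq0 : 0 < q) (hq1 : q < 1) (ht : t ≠ 0) :
    IsGLB ((fun Z : Matrix n n 𝕜 => q * RCLike.re (trace (A * Z ^ (-t))) +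
      (1 - q) * RCLike.re (trace (Z ^ (t * q / (1 - q))))) '' {Z | Z.PosDef})
      (RCLike.re (trace (A ^ q))) := by
  refine ⟨?_, fun c hc => ?_⟩
  · rintro - ⟨Z, hZ, rfl⟩
    exact re_trace_rpow_le_mul_add_mul hA hZ hq0 hq1 t
  refine ge_of_tendsto (tendsto_re_trace_add_smul_one_rpow hA hq0)
    (eventually_nhdsWithin_of_forall fun ε (hε : 0 < ε) => ?_)
  have hAε : (A + ε • 1).PosDef := PosDef.posSemidef_add hA (PosDef.one.smul hε)
  have hZ := posDef_rpow hAε ((1 - q) / t)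
  calc c ≤ q * RCLike.re (trace (A * ((A + ε • 1) ^ ((1 - q) / t)) ^ (-t))) +
        (1 - q) * RCLike.re (trace (((A + ε • 1) ^ ((1 - q) / t)) ^ (t * q / (1 - q)))) :=
        hc (mem_image_of_mem _ hZ)
    _ ≤ q * RCLike.re (trace ((A + ε • 1) * ((A + ε • 1) ^ ((1 - q) / t)) ^ (-t))) +
        (1 - q) * RCLike.re (trace (((A + ε • 1) ^ ((1 - q) / t)) ^ (t * q / (1 - q)))) := by
        gcongr q * ?_ + _
        exact re_trace_mul_le_re_trace_add_smul_one_mul (posDef_rpow hZ _).posSemidef hε.le A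
    _ = RCLike.re (trace ((A + ε • 1) ^ q)) :=
        re_trace_mul_rpow_add_re_trace_rpow_eq hAε hq1 ht

end TraceInequalities

theorem corollary4p5_general {s q : ℝ} (hs0 : 0 ≤ s) (hs1 : s < 1) (hq0 : 1 / (2 - s) ≤ q)
    (hq1 : q < 1) :
    ConvexOn ℝ ({A : Matrix m m 𝕜 | A.PosDef} ×ˢ (univ : Set (Matrix m n 𝕜))) fun p =>
      RCLike.re (trace ((p.2ᴴ * p.1 ^ (-s) * p.2) ^ q)) := by
  have hq : 0 < q := (one_div_pos.2 (by linarith)).trans_le hq0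
  have hq' : 0 < 1 - q := sub_pos.2 hq1
  have hr : 1 ≤ (1 - s) * q / (1 - q) := by
    rw [div_le_iff₀ (by linarith)] at hq0
    rw [le_div_iff₀ hq']
    linarith
  have hlieb := convexOn_re_trace_conjTranspose_mul_rpow_mul_mul_rpow (m := m) (n := n) (𝕜 := 𝕜)
    hs0 hs1
  have hpow := (convexOn_re_trace_rpow (n := n) (𝕜 := 𝕜) hr).comp_linearMap
    (LinearMap.snd ℝ (Matrix m m 𝕜 × Matrix m n 𝕜) (Matrix n n 𝕜))
  have hjoint := (hlieb.smul hq.le).add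
    ((hpow.subset (fun p hp => hp.2) hlieb.1).smul hq'.le)
  refine convexOn_of_isGLB_image hjoint fun p _ => ?_
  have hpos : (p.2ᴴ * p.1 ^ (-s) * p.2).PosSemidef :=
    (nonneg_iff_posSemidef.1 CFC.rpow_nonneg).conjTranspose_mul_mul_same p.2
  have hglb := isGLB_image_re_trace_rpow hpos hq hq1 (sub_pos.2 hs1).ne'
  rwa [neg_sub] at hglb

end

/-- For `0 ≤ s < 1` and `1 / (2 - s) ≤ q < 1`, the map `(A, B) ↦ tr[(B* A^{-s} B)^q]` is jointly
convex on positive definite matrices times all matrices. The trace is that of a positive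
semidefinite matrix, hence real; `.re` only moves it from `ℂ` to `ℝ`. -/
theorem corollary4p5 (n : ℕ) (s q : ℝ) (hs0 : 0 ≤ s) (hs1 : s < 1)
    (hq0 : 1 / (2 - s) ≤ q) (hq1 : q < 1) :
    ConvexOn ℝ
      ({A : Matrix (Fin n) (Fin n) ℂ | A.PosDef} ×ˢ (Set.univ : Set (Matrix (Fin n) (Fin n) ℂ)))
      (fun p : Matrix (Fin n) (Fin n) ℂ × Matrix (Fin n) (Fin n) ℂ =>
        (Matrix.trace ((p.2ᴴ * p.1 ^ (-s) * p.2) ^ q)).re) :=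
  corollary4p5_general hs0 hs1 hq0 hq1
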